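/- Let Alice and Bob hold a bipartite quantum system with state space $\mathbb{C}^2\otimes\mathbb{C}^2$. An LOCC measurement consists of finitely many rounds; in each round one of the parties, chosen depending on the outcomes so far, performs on its own subsystem a measurement with finitely many outcomes, given by operators $K_k$ (possibly into a space of another finite dimension) with $\sum_k K_k^\dagger K_k=1$, and announces the outcome. An outcome $\mu$ of the whole measurement is the complete record of local outcomes; it acts on states by an operator $A_\mu\otimes B_\mu$, has probability $\|(A_\mu\otimes B_\mu)\varphi\|^2$ on a unit vector $\varphi$, and, if this is nonzero, leaves the normalized state $(A_\mu\otimes B_\mu)\varphi/\|(A_\mu\otimes B_\mu)\varphi\|$. A set of states is locally distinguishable if there are an LOCC measurement and a rule assigning to each outcome a state of the set such that, on each state $\varphi$ of the set, every outcome of nonzero probability is assigned $\varphi$. For a set $S$ of states, let $S'_\mu$ be the set of states that the outcome $\mu$ leaves from those $\varphi\in S$ on which $\mu$ has nonzero probability. The measurement is orthogonality-preserving for $S$ (an OPLM) if, for each $\mu$, the states that $\mu$ leaves from distinct states of $S$ are mutually orthogonal; measurements by a single party are included as the case of one round. (i) Let $2\le n\le 4$ and let $S=\{\varphi_1,\dots,\varphi_n\}$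 be a locally distinguishable set of $n$ mutually orthogonal unit vectors in $\mathbb{C}^2\otimes\mathbb{C}^2$. Then for every OPLM for $S$ and every outcome $\mu$ that has nonzero probability on at least one state of $S$, the transformed set $S'_\mu$ is locally distinguishable. (ii) Consequently there is no activable nonlocality, and in particular no genuine activable nonlocality, in two qubits: there is no finite locally distinguishable set $S$ of mutually orthogonal unit vectors in $\mathbb{C}^2\otimes\mathbb{C}^2$ that has an OPLM for which $S'_\mu$ is locally indistinguishable for every outcome $\mu$ that has nonzero probability on at least one state of $S$. -/

import Mathlib

open scoped Kronecker Matrix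

/-- The state space `ℂᵃ ⊗ ℂᵇ` of a bipartite system, in the product basis `|x⟩ ⊗ |y⟩`. -/
abbrev Bipartite (a b : ℕ) : Type := EuclideanSpace ℂ (Fin a × Fin b)

/-- A (finite-round) LOCC measurement on `ℂᵃ ⊗ ℂᵇ`. Either the parties stop, or one of them
performs a measurement with finitely many outcomes `k` and measurement operators `K k`,
`∑ k, (K k)† (K k) = 1`, on its own subsystem, announces the outcome, and they go on in a way that
may depend on it. Measurement operators may map to a space of another dimension, so local ancillas
are covered. A measurement by a single party is a tree with one round. -/
inductive LOCC : ℕ → ℕ → Type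
  | finish {a b : ℕ} : LOCC a b
  | alice {a b : ℕ} (m a' : ℕ) (K : Fin m → Matrix (Fin a') (Fin a) ℂ)
      (hK : ∑ k, (K k)ᴴ * K k = 1) (next : Fin m → LOCC a' b) : LOCC a b
  | bob {a b : ℕ} (m b' : ℕ) (K : Fin m → Matrix (Fin b') (Fin b) ℂ)
      (hK : ∑ k, (K k)ᴴ * K k = 1) (next : Fin m → LOCC a b') : LOCC a b

namespace LOCC

/-- The outcomes of an LOCC measurement: the complete records of all local outcomes. -/
inductive Outcome : {a b : ℕ} → LOCC a b → Type
  | finish {a b : ℕ} : Outcome (LOCC.finish (a := a) (b := b))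
  | alice {a b m a' : ℕ} {K : Fin m → Matrix (Fin a') (Fin a) ℂ}
      {hK : ∑ k, (K k)ᴴ * K k = 1} {next : Fin m → LOCC a' b}
      (k : Fin m) (o : Outcome (next k)) : Outcome (LOCC.alice m a' K hK next)
  | bob {a b m b' : ℕ} {K : Fin m → Matrix (Fin b') (Fin b) ℂ}
      {hK : ∑ k, (K k)ᴴ * K k = 1} {next : Fin m → LOCC a b'}
      (k : Fin m) (o : Outcome (next k)) : Outcome (LOCC.bob m b' K hK next)

/-- Dimension of Alice's system after the given outcome. -/
def dimA : {a b : ℕ} → (P : LOCC a b) → P.Outcome → ℕ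
  | a, _, _, .finish => a
  | _, _, .alice _ _ _ _ next, .alice k o => (next k).dimA o
  | _, _, .bob _ _ _ _ next, .bob k o => (next k).dimA o

/-- Dimension of Bob's system after the given outcome. -/
def dimB : {a b : ℕ} → (P : LOCC a b) → P.Outcome → ℕ
  | _, b, _, .finish => b
  | _, _, .alice _ _ _ _ next, .alice k o => (next k).dimB o
  | _, _, .bob _ _ _ _ next, .bob k o => (next k).dimB o

/-- The product of the operators that Alice has applied when the given outcome occurs. -/
noncomputable def opA : {a b : ℕ} → (P : LOCC a b) → (o : P.Outcome) →
    Matrix (Fin (P.dimA o)) (Fin a) ℂ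
  | a, _, _, .finish => (1 : Matrix (Fin a) (Fin a) ℂ)
  | _, _, .alice _ _ K _ next, .alice k o => (next k).opA o * K k
  | _, _, .bob _ _ _ _ next, .bob k o => (next k).opA o

/-- The product of the operators that Bob has applied when the given outcome occurs. -/
noncomputable def opB : {a b : ℕ} → (P : LOCC a b) → (o : P.Outcome) →
    Matrix (Fin (P.dimB o)) (Fin b) ℂ
  | _, b, _, .finish => (1 : Matrix (Fin b) (Fin b) ℂ)
  | _, _, .alice _ _ _ _ next, .alice k o => (next k).opB o
  | _, _, .bob _ _ K _ next, .bob k o => (next k).opB o * K k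

/-- The unnormalized state `(A ⊗ B) ψ` after the outcome `o`. -/
noncomputable def apply {a b : ℕ} (P : LOCC a b) (o : P.Outcome) (ψ : Bipartite a b) :
    Bipartite (P.dimA o) (P.dimB o) :=
  Matrix.toEuclideanLin (P.opA o ⊗ₖ P.opB o) ψ

/-- The probability of the outcome `o` on the (unit) state `ψ`. -/
noncomputable def prob {a b : ℕ} (P : LOCC a b) (o : P.Outcome) (ψ : Bipartite a b) : ℝ :=
  ‖P.apply o ψ‖ ^ 2

/-- The normalized post-measurement state after the outcome `o` (meaningful if `o` has nonzero
probability on `ψ`). -/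
noncomputable def postState {a b : ℕ} (P : LOCC a b) (o : P.Outcome) (ψ : Bipartite a b) :
    Bipartite (P.dimA o) (P.dimB o) :=
  ((‖P.apply o ψ‖⁻¹ : ℝ) : ℂ) • P.apply o ψ

/-- The states of the family `φ` that are not eliminated by the outcome `o`. -/
abbrev Survivor {a b : ℕ} (P : LOCC a b) (o : P.Outcome) {ι : Type} (φ : ι → Bipartite a b) :
    Type :=
  {i : ι // 0 < P.prob o (φ i)}

/-- The transformed set after the outcome `o`: the post-measurement states of those states that
are not eliminated. -/
noncomputable def transformed {a b : ℕ} (P : LOCC a b) (o : P.Outcome) {ι : Type}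
    (φ : ι → Bipartite a b) (i : P.Survivor o φ) : Bipartite (P.dimA o) (P.dimB o) :=
  P.postState o (φ i.1)

/-- `P` preserves the orthogonality of the family `φ`: after every outcome, the post-measurement
states of the states that are not eliminated are mutually orthogonal. -/
def PreservesOrthogonality {a b : ℕ} (P : LOCC a b) {ι : Type} (φ : ι → Bipartite a b) : Prop :=
  ∀ o : P.Outcome, Pairwise fun i j => inner ℂ (P.transformed o φ i) (P.transformed o φ j) = 0

end LOCC

/-- A family of states is locally distinguishable if some LOCC measurement identifies the given
state with certainty: every outcome that can occur on the state `φ i` leads to the guess `i`. -/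
def LocallyDistinguishable {a b : ℕ} {ι : Type} (φ : ι → Bipartite a b) : Prop :=
  ∃ (P : LOCC a b) (guess : P.Outcome → ι), ∀ i o, 0 < P.prob o (φ i) → guess o = i

/-- A family of states has activable nonlocality if it is locally distinguishable but some
orthogonality-preserving local measurement transforms it, whatever the outcome, into a locally
indistinguishable family. (Outcomes that have probability zero on all states are disregarded. It is
not required here that no state is eliminated, nor that there is no local redundancy.) -/
def ActivableNonlocality {a b : ℕ} {ι : Type} (φ : ι → Bipartite a b) : Prop :=
  LocallyDistinguishable φ ∧
    ∃ P : LOCC a b, P.PreservesOrthogonality φ ∧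
      ∀ o : P.Outcome, Nonempty (P.Survivor o φ) →
        ¬ LocallyDistinguishable (P.transformed o φ)

/-! A state is encoded by its coefficient matrix `X`; an outcome acts by `X ↦ A * X * Bᵀ`, and a
two-qubit state is a product exactly when `X.det = 0`.

Local distinguishability of orthogonal two-qubit states depends only on how many of them are
products. For necessity, follow a protocol as long as the local operators are multiples of
isometries. Since at least two states must be told apart, some operator `K` is eventually not of
this kind. Orthogonality survives `K`, so the non-scalar Hermitian matrix `M = Kᴴ * K` satisfies `tr
(Xᵢᴴ * M * Xⱼ) = 0` for `i ≠ j`. The same holds for `1`, hence for both eigenprojections of `M`: one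
party can start with an orthonormal measurement leaving the other with orthogonal vectors in `ℂ²`
(`MatrixDistinguishable.rowSplit`). As `ℂ²` holds at most two nonzero orthogonal vectors, among
three states at most one is entangled, and among four none is.

Conversely, these counts suffice for orthogonal states (`of_two`, `of_three`, `of_four`): in each
case a suitable non-scalar `M` is found. Local operators send products to products, and the images,
living in larger spaces, compress back to two qubits (`exists_two_qubit_reduction`). The counts
therefore pass to the survivors of any outcome that keeps orthogonality. -/

/-! ### Coefficient matrices of bipartite states -/

/-- The coefficient matrix of a bipartite state in the product basis. -/
def Bipartite.toMatrix {a b : ℕ} (ψ : Bipartite a b) : Matrix (Fin a) (Fin b) ℂ :=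
  Matrix.of fun i j => ψ (i, j)

theorem Bipartite.toMatrix_eq_zero {a b : ℕ} {ψ : Bipartite a b} : ψ.toMatrix = 0 ↔ ψ = 0 := by
  constructor
  · intro h
    ext ⟨i, j⟩
    exact congrFun (congrFun h i) j
  · rintro rfl
    rfl

theorem Bipartite.toMatrix_smul {a b : ℕ} (c : ℂ) (ψ : Bipartite a b) :
    Bipartite.toMatrix (c • ψ) = c • ψ.toMatrix := rfl

theorem Bipartite.inner_eq_trace {a b : ℕ} (φ ψ : Bipartite a b) :
    inner ℂ φ ψ = (φ.toMatrixᴴ * ψ.toMatrix).trace := by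
  simp only [PiLp.inner_apply, Matrix.trace, Matrix.diag, Matrix.mul_apply,
    Matrix.conjTranspose_apply, Fintype.sum_prod_type, Bipartite.toMatrix, Matrix.of_apply]
  rw [Finset.sum_comm]
  refine Finset.sum_congr rfl fun j _ => Finset.sum_congr rfl fun i _ => ?_
  simp [mul_comm]

theorem LOCC.toMatrix_apply {a b : ℕ} (P : LOCC a b) (o : P.Outcome) (ψ : Bipartite a b) :
    (P.apply o ψ).toMatrix = P.opA o * ψ.toMatrix * (P.opB o)ᵀ := by
  ext i j
  simp only [LOCC.apply, Bipartite.toMatrix, Matrix.of_apply, Matrix.toLpLin_apply,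
    Matrix.mulVec, dotProduct, Fintype.sum_prod_type, Matrix.mul_apply, Matrix.transpose_apply,
    Matrix.kroneckerMap_apply, Finset.sum_mul]
  rw [Finset.sum_comm]
  refine Finset.sum_congr rfl fun j _ => Finset.sum_congr rfl fun i _ => ?_
  ring

/-! ### LOCC protocols acting on coefficient matrices -/

/-- Local distinguishability of a family of states given by their coefficient matrices, as an
inductive predicate. -/
inductive MatrixDistinguishable {ι : Type} :
    {a b : ℕ} → (ι → Matrix (Fin a) (Fin b) ℂ) → Prop
  | finish {a b : ℕ} {X : ι → Matrix (Fin a) (Fin b) ℂ} (i : ι) (h : ∀ j, X j ≠ 0 → i = j) :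
      MatrixDistinguishable X
  | alice {a b : ℕ} {X : ι → Matrix (Fin a) (Fin b) ℂ} (m a' : ℕ)
      (K : Fin m → Matrix (Fin a') (Fin a) ℂ) (hK : ∑ k, (K k)ᴴ * K k = 1)
      (h : ∀ k, MatrixDistinguishable fun i => K k * X i) : MatrixDistinguishable X
  | bob {a b : ℕ} {X : ι → Matrix (Fin a) (Fin b) ℂ} (m b' : ℕ)
      (K : Fin m → Matrix (Fin b') (Fin b) ℂ) (hK : ∑ k, (K k)ᴴ * K k = 1)
      (h : ∀ k, MatrixDistinguishable fun i => X i * (K k)ᵀ) : MatrixDistinguishable X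

theorem MatrixDistinguishable.of_guess {ι : Type} : ∀ {a b : ℕ} (P : LOCC a b)
    (X : ι → Matrix (Fin a) (Fin b) ℂ) (guess : P.Outcome → ι),
    (∀ i o, P.opA o * X i * (P.opB o)ᵀ ≠ 0 → guess o = i) → MatrixDistinguishable X
  | a, b, .finish, X, guess, h => by
    refine .finish (guess .finish) fun j hj => h j .finish ?_
    change (1 : Matrix (Fin a) (Fin a) ℂ) * X j * (1 : Matrix (Fin b) (Fin b) ℂ)ᵀ ≠ 0
    simpa using hj
  | _, _, .alice m a' K hK next, X, guess, h => by
    refine .alice m a' K hK fun k => of_guess (next k) _ (fun o => guess (.alice k o)) ?_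
    intro i o ho
    refine h i (.alice k o) ?_
    change (next k).opA o * K k * X i * ((next k).opB o)ᵀ ≠ 0
    simpa only [Matrix.mul_assoc] using ho
  | _, _, .bob m b' K hK next, X, guess, h => by
    refine .bob m b' K hK fun k => of_guess (next k) _ (fun o => guess (.bob k o)) ?_
    intro i o ho
    refine h i (.bob k o) ?_
    change (next k).opA o * X i * ((next k).opB o * K k)ᵀ ≠ 0
    simpa only [Matrix.mul_assoc, Matrix.transpose_mul] using ho

theorem MatrixDistinguishable.exists_guess {ι : Type} {a b : ℕ}
    {X : ι → Matrix (Fin a) (Fin b) ℂ} (hX : MatrixDistinguishable X) :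
    ∃ (P : LOCC a b) (guess : P.Outcome → ι),
      ∀ i o, P.opA o * X i * (P.opB o)ᵀ ≠ 0 → guess o = i := by
  induction hX with
  | @finish a b X i h =>
    refine ⟨.finish, fun _ => i, fun j o => ?_⟩
    cases o
    intro hj
    change (1 : Matrix (Fin a) (Fin a) ℂ) * X j * (1 : Matrix (Fin b) (Fin b) ℂ)ᵀ ≠ 0 at hj
    exact h j (by simpa using hj)
  | @alice a b X m a' K hK _ ih =>
    choose P guess hg using ih
    refine ⟨.alice m a' K hK P, fun o => match o with | .alice k o => guess k o, fun i o => ?_⟩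
    cases o with
    | alice k o =>
      intro ho
      change (P k).opA o * K k * X i * ((P k).opB o)ᵀ ≠ 0 at ho
      exact hg k i o (by simpa only [Matrix.mul_assoc] using ho)
  | @bob a b X m b' K hK _ ih =>
    choose P guess hg using ih
    refine ⟨.bob m b' K hK P, fun o => match o with | .bob k o => guess k o, fun i o => ?_⟩
    cases o with
    | bob k o =>
      intro ho
      change (P k).opA o * X i * ((P k).opB o * K k)ᵀ ≠ 0 at ho
      exact hg k i o (by simpa only [Matrix.mul_assoc, Matrix.transpose_mul] using ho)

theorem LOCC.prob_pos_iff {a b : ℕ} (P : LOCC a b) (o : P.Outcome) (ψ : Bipartite a b) :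
    0 < P.prob o ψ ↔ P.opA o * ψ.toMatrix * (P.opB o)ᵀ ≠ 0 := by
  rw [← LOCC.toMatrix_apply, Bipartite.toMatrix_eq_zero.ne, LOCC.prob, ← norm_ne_zero_iff]
  constructor
  · intro h h0
    simp [h0] at h
  · intro h
    positivity

theorem locallyDistinguishable_iff {a b : ℕ} {ι : Type} (φ : ι → Bipartite a b) :
    LocallyDistinguishable φ ↔ MatrixDistinguishable fun i => (φ i).toMatrix := by
  constructor
  · rintro ⟨P, guess, h⟩
    exact .of_guess P _ guess fun i o ho => h i o ((P.prob_pos_iff o _).2 ho)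
  · intro h
    obtain ⟨P, guess, h⟩ := h.exists_guess
    exact ⟨P, guess, fun i o ho => h i o ((P.prob_pos_iff o _).1 ho)⟩

theorem exists_mul_ne_zero {a b a' m : ℕ} {K : Fin m → Matrix (Fin a') (Fin a) ℂ}
    (hK : ∑ k, (K k)ᴴ * K k = 1) {X : Matrix (Fin a) (Fin b) ℂ} (hX : X ≠ 0) :
    ∃ k, K k * X ≠ 0 := by
  by_contra! h
  apply hX
  rw [← Matrix.one_mul X, ← hK, Matrix.sum_mul]
  exact Finset.sum_eq_zero fun k _ => by rw [Matrix.mul_assoc, h, Matrix.mul_zero]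

theorem LOCC.exists_outcome : ∀ {a b : ℕ} (P : LOCC a b) (X : Matrix (Fin a) (Fin b) ℂ),
    X ≠ 0 → ∃ o : P.Outcome, P.opA o * X * (P.opB o)ᵀ ≠ 0
  | a, b, .finish, X, hX => by
    refine ⟨.finish, ?_⟩
    change (1 : Matrix (Fin a) (Fin a) ℂ) * X * (1 : Matrix (Fin b) (Fin b) ℂ)ᵀ ≠ 0
    simpa using hX
  | _, _, .alice m a' K hK next, X, hX => by
    obtain ⟨k, hk⟩ := exists_mul_ne_zero hK hX
    obtain ⟨o, ho⟩ := exists_outcome (next k) _ hk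
    refine ⟨.alice k o, ?_⟩
    change (next k).opA o * K k * X * ((next k).opB o)ᵀ ≠ 0
    simpa only [Matrix.mul_assoc] using ho
  | _, _, .bob m b' K hK next, X, hX => by
    obtain ⟨k, hk⟩ := exists_mul_ne_zero hK (mt Matrix.transpose_eq_zero.1 hX)
    have hk' : X * (K k)ᵀ ≠ 0 := by
      intro h0
      apply hk
      rw [← Matrix.transpose_eq_zero, Matrix.transpose_mul, Matrix.transpose_transpose, h0]
    obtain ⟨o, ho⟩ := exists_outcome (next k) _ hk'
    refine ⟨.bob k o, ?_⟩
    change (next k).opA o * X * ((next k).opB o * K k)ᵀ ≠ 0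
    simpa only [Matrix.mul_assoc, Matrix.transpose_mul] using ho

/-- Transposition exchanges Alice and Bob, so later arguments need to treat only one of them. -/
theorem MatrixDistinguishable.transpose {ι : Type} {a b : ℕ}
    {X : ι → Matrix (Fin a) (Fin b) ℂ} (hX : MatrixDistinguishable X) :
    MatrixDistinguishable fun i => (X i)ᵀ := by
  induction hX with
  | finish i h => exact .finish i fun j hj => h j (mt Matrix.transpose_eq_zero.2 hj)
  | alice m a' K hK _ ih => exact .bob m a' K hK (by simpa only [Matrix.transpose_mul] using ih)
  | bob m b' K hK _ ih =>
    exact .alice m b' K hK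
      (by simpa only [Matrix.transpose_mul, Matrix.transpose_transpose] using ih)

theorem sum_trace_conjTranspose_mul {a b a' m : ℕ} {K : Fin m → Matrix (Fin a') (Fin a) ℂ}
    (hK : ∑ k, (K k)ᴴ * K k = 1) (X Y : Matrix (Fin a) (Fin b) ℂ) :
    ∑ k, ((K k * X)ᴴ * (K k * Y)).trace = (Xᴴ * Y).trace := by
  have : ∀ k, (K k * X)ᴴ * (K k * Y) = Xᴴ * ((K k)ᴴ * K k) * Y := fun k => by
    simp only [Matrix.conjTranspose_mul, Matrix.mul_assoc]
  simp only [this]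
  rw [← Matrix.trace_sum, ← Matrix.sum_mul, ← Matrix.mul_sum, hK, Matrix.mul_one]

theorem trace_conjTranspose_mul_transpose {a b : ℕ} (X Y : Matrix (Fin a) (Fin b) ℂ) :
    (Xᵀᴴ * Yᵀ).trace = (Xᴴ * Y).trace := by
  rw [← Matrix.trace_transpose, Matrix.transpose_mul, Matrix.transpose_transpose,
    Matrix.trace_mul_comm]
  rfl

/-- By completeness of the operators, an inner product is the sum of its values after the outcomes
of a round. At a leaf at most one state is nonzero, so every term vanishes. -/
theorem MatrixDistinguishable.trace_eq_zero {ι : Type} {a b : ℕ}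
    {X : ι → Matrix (Fin a) (Fin b) ℂ} (hX : MatrixDistinguishable X) {i j : ι} (hij : i ≠ j) :
    ((X i)ᴴ * X j).trace = 0 := by
  induction hX with
  | @finish a b X s h =>
    by_cases hi : X i = 0
    · simp [hi]
    · by_cases hj : X j = 0
      · simp [hj]
      · exact absurd ((h i hi).symm.trans (h j hj)) hij
  | @alice a b X m a' K hK _ ih =>
    rw [← sum_trace_conjTranspose_mul hK]
    exact Finset.sum_eq_zero fun k _ => ih k
  | @bob a b X m b' K hK _ ih =>
    rw [← trace_conjTranspose_mul_transpose, ← sum_trace_conjTranspose_mul hK]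
    refine Finset.sum_eq_zero fun k _ => ?_
    rw [← ih k, ← trace_conjTranspose_mul_transpose (X i * _), Matrix.transpose_mul,
      Matrix.transpose_mul, Matrix.transpose_transpose]

/-! ### Orthogonality-preserving measurements in an orthonormal basis -/

/-- Some orthonormal measurement on the first qubit leaves pairwise orthogonal states of the second
system, whatever the outcome. -/
def RowSplit {ι : Type} {b : ℕ} (X : ι → Matrix (Fin 2) (Fin b) ℂ) : Prop :=
  ∃ U : Matrix (Fin 2) (Fin 2) ℂ, Uᴴ * U = 1 ∧
    ∀ k i j, i ≠ j → star ((U * X i) k) ⬝ᵥ (U * X j) k = 0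

theorem trace_mul_diagonal_mul {b : ℕ} (Y Z : Matrix (Fin 2) (Fin b) ℂ) (d : Fin 2 → ℂ) :
    (Yᴴ * Matrix.diagonal d * Z).trace = ∑ k, d k * (star (Y k) ⬝ᵥ Z k) := by
  simp only [Matrix.trace, Matrix.diag, Matrix.mul_apply (N := Z), Matrix.mul_diagonal,
    dotProduct, Matrix.conjTranspose_apply, Finset.mul_sum, Pi.star_apply]
  rw [Finset.sum_comm]
  refine Finset.sum_congr rfl fun i _ => Finset.sum_congr rfl fun j _ => ?_
  ring

/-- The measurement is in an eigenbasis of `M`. On a qubit a non-scalar `M` has two distinct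
eigenvalues, so `1` and `M` span both eigenprojections, and orthogonality with respect to `1` and
`M` gives it for each projection. -/
theorem RowSplit.of_trace {ι : Type} {b : ℕ} {X : ι → Matrix (Fin 2) (Fin b) ℂ}
    (hX : ∀ i j, i ≠ j → ((X i)ᴴ * X j).trace = 0) {M : Matrix (Fin 2) (Fin 2) ℂ}
    (hM : M.IsHermitian) (hM' : ∀ c : ℂ, M ≠ c • 1)
    (h : ∀ i j, i ≠ j → ((X i)ᴴ * M * X j).trace = 0) : RowSplit X := by
  set V : Matrix (Fin 2) (Fin 2) ℂ := (hM.eigenvectorUnitary : Matrix (Fin 2) (Fin 2) ℂ)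
  have hVV : V * Vᴴ = 1 := Unitary.coe_mul_star_self hM.eigenvectorUnitary
  set d : Fin 2 → ℂ := RCLike.ofReal ∘ hM.eigenvalues
  have hspec : M = V * Matrix.diagonal d * Vᴴ := by
    have := hM.spectral_theorem
    rwa [Unitary.conjStarAlgAut_apply] at this
  have hne : d 0 - d 1 ≠ 0 := by
    intro h0
    apply hM' (d 1)
    have : Matrix.diagonal d = d 1 • (1 : Matrix (Fin 2) (Fin 2) ℂ) := by
      rw [← Matrix.diagonal_one, ← Matrix.diagonal_smul]
      congr 1
      ext k
      fin_cases k
      · simpa using sub_eq_zero.1 h0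
      · simp
    rw [hspec, this, Matrix.mul_smul, Matrix.smul_mul, Matrix.mul_one, hVV]
  refine ⟨Vᴴ, by rwa [Matrix.conjTranspose_conjTranspose], ?_⟩
  have key : ∀ i j, i ≠ j → (star ((Vᴴ * X i) 0) ⬝ᵥ (Vᴴ * X j) 0 = 0 ∧
      star ((Vᴴ * X i) 1) ⬝ᵥ (Vᴴ * X j) 1 = 0) := by
    intro i j hij
    have h1 := trace_mul_diagonal_mul (Vᴴ * X i) (Vᴴ * X j) d
    have h2 := trace_mul_diagonal_mul (Vᴴ * X i) (Vᴴ * X j) fun _ => 1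
    have e1 : (Vᴴ * X i)ᴴ * Matrix.diagonal d * (Vᴴ * X j) = (X i)ᴴ * M * X j := by
      rw [hspec]
      simp only [Matrix.conjTranspose_mul, Matrix.conjTranspose_conjTranspose, Matrix.mul_assoc]
    have e2 : (Vᴴ * X i)ᴴ * Matrix.diagonal (fun _ : Fin 2 => (1 : ℂ)) * (Vᴴ * X j) =
        (X i)ᴴ * X j := by
      rw [Matrix.diagonal_one, Matrix.mul_one, Matrix.conjTranspose_mul,
        Matrix.conjTranspose_conjTranspose, Matrix.mul_assoc, ← Matrix.mul_assoc V, hVV,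
        Matrix.one_mul]
    rw [e1, h i j hij, Fin.sum_univ_two] at h1
    rw [e2, hX i j hij, Fin.sum_univ_two] at h2
    simp only [one_mul] at h2
    -- Two linear equations for the two row products, with determinant `d 0 - d 1` up to sign.
    have h3 : (d 0 - d 1) * (star ((Vᴴ * X i) 0) ⬝ᵥ (Vᴴ * X j) 0) = 0 := by
      linear_combination -h1 + d 1 * h2
    have h4 := (mul_eq_zero.1 h3).resolve_left hne
    exact ⟨h4, by rw [h4, zero_add] at h2; exact h2.symm⟩
  intro k i j hij
  fin_cases k
  · exact (key i j hij).1
  · exact (key i j hij).2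

/-- A version of `RowSplit.of_trace` in which pairs containing an eigenstate need no check. -/
theorem RowSplit.of_eigen {ι : Type} {b : ℕ} {X : ι → Matrix (Fin 2) (Fin b) ℂ}
    (hX : ∀ i j, i ≠ j → ((X i)ᴴ * X j).trace = 0) {M : Matrix (Fin 2) (Fin 2) ℂ}
    (hM : M.IsHermitian) (hM' : ∀ c : ℂ, M ≠ c • 1)
    (h : ∀ i j, i ≠ j → (∃ c : ℂ, M * X i = c • X i) ∨ (∃ c : ℂ, M * X j = c • X j) ∨
      ((X i)ᴴ * M * X j).trace = 0) : RowSplit X := by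
  refine .of_trace hX hM hM' fun i j hij => ?_
  obtain ⟨c, hc⟩ | ⟨c, hc⟩ | h0 := h i j hij
  · have : (X i)ᴴ * M = star c • (X i)ᴴ := by
      rw [← Matrix.conjTranspose_smul, ← hc, Matrix.conjTranspose_mul, hM.eq]
    rw [this, Matrix.smul_mul, Matrix.trace_smul, hX i j hij, smul_zero]
  · rw [Matrix.mul_assoc, hc, Matrix.mul_smul, Matrix.trace_smul, hX i j hij, smul_zero]
  · exact h0

theorem isHermitian_vecMulVec_star (u : Fin 2 → ℂ) :
    (Matrix.vecMulVec u (star u)).IsHermitian := by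
  ext i j
  simp [Matrix.vecMulVec_apply, mul_comm]

theorem vecMulVec_star_ne_smul_one {u : Fin 2 → ℂ} (hu : u ≠ 0) (c : ℂ) :
    Matrix.vecMulVec u (star u) ≠ c • 1 := by
  intro h
  have h00 := congrFun (congrFun h 0) 0
  have h11 := congrFun (congrFun h 1) 1
  have h01 := congrFun (congrFun h 0) 1
  simp [Matrix.vecMulVec_apply] at h00 h11 h01
  have : u 0 = 0 ∧ u 1 = 0 := by
    rcases h01 with h | h
    · refine ⟨h, ?_⟩
      rw [← h00, h] at h11
      simpa using h11
    · refine ⟨?_, h⟩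
      rw [← h11, h] at h00
      simpa using h00
  apply hu
  ext k
  fin_cases k
  · exact this.1
  · exact this.2

/-! ### From an orthonormal measurement to a full protocol -/

/-- A measurement in an orthonormal basis of the first qubit. -/
theorem MatrixDistinguishable.of_rows {ι : Type} {b : ℕ} {X : ι → Matrix (Fin 2) (Fin b) ℂ}
    {U : Matrix (Fin 2) (Fin 2) ℂ} (hU : Uᴴ * U = 1)
    (h : ∀ k, MatrixDistinguishable fun i => Matrix.of fun (_ : Fin 1) => (U * X i) k) :
    MatrixDistinguishable X := by
  -- Each outcome maps Alice's qubit to a one-dimensional space, so only Bob's vector remains.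
  refine .alice 2 1 (fun k => Matrix.of fun _ => U k) ?_ fun k => ?_
  · rw [← hU]
    ext i j
    simp [Matrix.mul_apply, Matrix.sum_apply]
  · convert h k using 2
    ext
    simp [Matrix.mul_apply]

theorem MatrixDistinguishable.of_one_by_one {ι : Type} [Nonempty ι]
    {X : ι → Matrix (Fin 1) (Fin 1) ℂ} (h : ∀ i j, i ≠ j → star (X i 0) ⬝ᵥ X j 0 = 0) :
    MatrixDistinguishable X := by
  have hz : ∀ i, X i ≠ 0 → X i 0 0 ≠ 0 := fun i hi h0 => hi <| by
    ext a b
    rw [Subsingleton.elim a 0, Subsingleton.elim b 0, h0]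
    rfl
  by_cases h0 : ∃ i, X i ≠ 0
  · obtain ⟨i, hi⟩ := h0
    refine .finish i fun j hj => ?_
    by_contra hij
    have := h i j hij
    simp [dotProduct, hz i hi, hz j hj] at this
  · push Not at h0
    exact .finish (Classical.arbitrary ι) fun j hj => absurd (h0 j) hj

/-- Bob measures along one nonzero vector of the family. The others are orthogonal to it, so every
state is an eigenstate of the projector and `RowSplit.of_eigen` applies. -/
theorem MatrixDistinguishable.of_one_by_two {ι : Type} [Nonempty ι]
    {X : ι → Matrix (Fin 1) (Fin 2) ℂ} (h : ∀ i j, i ≠ j → star (X i 0) ⬝ᵥ X j 0 = 0) :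
    MatrixDistinguishable X := by
  by_cases h0 : ∃ i, X i ≠ 0
  · obtain ⟨s, hs⟩ := h0
    have hs' : X s 0 ≠ 0 := fun h0 => hs <| by
      ext a b
      rw [Subsingleton.elim a 0, h0]
      rfl
    have hX : ∀ i j, i ≠ j → ((X i)ᵀᴴ * (X j)ᵀ).trace = 0 := fun i j hij => by
      rw [← h i j hij]
      simp [Matrix.trace, Matrix.mul_apply, dotProduct]
    have key : RowSplit fun i => (X i)ᵀ := by
      refine .of_eigen hX (isHermitian_vecMulVec_star (X s 0)) (vecMulVec_star_ne_smul_one hs')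
        fun i j hij => ?_
      have hmul : ∀ i, Matrix.vecMulVec (X s 0) (star (X s 0)) * (X i)ᵀ =
          Matrix.of fun r _ => (star (X s 0) ⬝ᵥ X i 0) * X s 0 r := fun i => by
        ext r t
        simp [Matrix.mul_apply, Matrix.vecMulVec_apply, dotProduct, Subsingleton.elim t 0]
        ring
      have hz : ∀ i, s ≠ i → ∃ c : ℂ,
          Matrix.vecMulVec (X s 0) (star (X s 0)) * (X i)ᵀ = c • (X i)ᵀ := fun i hi => by
        refine ⟨0, ?_⟩
        rw [hmul, h s i hi, zero_smul]
        ext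
        simp
      by_cases hi : s = i
      · exact .inr (.inl (hz j (hi ▸ hij)))
      · exact .inl (hz i hi)
    obtain ⟨U, hU, hUX⟩ := key
    exact (MatrixDistinguishable.of_rows hU fun k => .of_one_by_one (hUX k)).transpose
  · push Not at h0
    exact .finish (Classical.arbitrary ι) fun j hj => absurd (h0 j) hj

theorem RowSplit.matrixDistinguishable {ι : Type} [Nonempty ι]
    {X : ι → Matrix (Fin 2) (Fin 2) ℂ} (h : RowSplit X) : MatrixDistinguishable X := by
  obtain ⟨U, hU, hUX⟩ := h
  exact .of_rows hU fun k => .of_one_by_two (hUX k)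

/-! ### Product states forced by a split -/

theorem star_dotProduct_eq_zero_symm {v w : Fin 2 → ℂ} (h : star v ⬝ᵥ w = 0) :
    star w ⬝ᵥ v = 0 := by
  rw [Matrix.star_dotProduct, h, star_zero]

theorem eq_zero_of_pairwise_orthogonal {x y z : Fin 2 → ℂ} (hxy : star x ⬝ᵥ y = 0)
    (hxz : star x ⬝ᵥ z = 0) (hyz : star y ⬝ᵥ z = 0) : x = 0 ∨ y = 0 ∨ z = 0 := by
  by_contra! h
  obtain ⟨hx, hy, hz⟩ := h
  let f : Fin 3 → EuclideanSpace ℂ (Fin 2) := fun k => WithLp.toLp 2 (![x, y, z] k)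
  have hf : LinearIndependent ℂ f := by
    refine linearIndependent_of_ne_zero_of_inner_eq_zero (𝕜 := ℂ) ?_ ?_
    · intro k h0
      have h1 : (![x, y, z] k) = 0 := congrArg WithLp.ofLp h0
      fin_cases k
      · exact hx h1
      · exact hy h1
      · exact hz h1
    · intro k l hkl
      rw [EuclideanSpace.inner_eq_star_dotProduct, dotProduct_comm]
      change star (![x, y, z] k) ⬝ᵥ (![x, y, z] l) = 0
      fin_cases k <;> fin_cases l
      · exact absurd rfl hkl
      · exact hxy
      · exact hxz
      · exact star_dotProduct_eq_zero_symm hxy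
      · exact absurd rfl hkl
      · exact hyz
      · exact star_dotProduct_eq_zero_symm hxz
      · exact star_dotProduct_eq_zero_symm hyz
      · exact absurd rfl hkl
  have := hf.fintype_card_le_finrank
  simp at this

theorem det_eq_zero_of_mul_row_eq_zero {U X : Matrix (Fin 2) (Fin 2) ℂ} (hU : Uᴴ * U = 1)
    (r : Fin 2) (h : (U * X) r = 0) : X.det = 0 := by
  have hUdet : U.det ≠ 0 := fun h0 => by
    have := congrArg Matrix.det hU
    simp [h0] at this
  have := Matrix.det_eq_zero_of_row_eq_zero r fun s => congrFun h s
  rw [Matrix.det_mul] at this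
  exact (mul_eq_zero.1 this).resolve_left hUdet

theorem eq_zero_of_mul_rows_eq_zero {U X : Matrix (Fin 2) (Fin 2) ℂ} (hU : Uᴴ * U = 1)
    (h0 : (U * X) 0 = 0) (h1 : (U * X) 1 = 0) : X = 0 := by
  have : U * X = 0 := by
    ext r s
    fin_cases r
    · exact congrFun h0 s
    · exact congrFun h1 s
  rw [← Matrix.one_mul X, ← hU, Matrix.mul_assoc, this, Matrix.mul_zero]

/-- In each row one of the three vectors vanishes. A vanishing row makes a state a product, and the
third state cannot vanish in both rows. -/
theorem RowSplit.det_eq_zero_of_three {ι : Type} {X : ι → Matrix (Fin 2) (Fin 2) ℂ}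
    (h : RowSplit X) {i j k : ι} (hij : i ≠ j) (hik : i ≠ k) (hjk : j ≠ k) (hk : X k ≠ 0) :
    (X i).det = 0 ∨ (X j).det = 0 := by
  obtain ⟨U, hU, hUX⟩ := h
  have hrow : ∀ r, (U * X i) r = 0 ∨ (U * X j) r = 0 ∨ (U * X k) r = 0 := fun r =>
    eq_zero_of_pairwise_orthogonal (hUX r i j hij) (hUX r i k hik) (hUX r j k hjk)
  obtain h0 | h0 | h0 := hrow 0
  · exact .inl (det_eq_zero_of_mul_row_eq_zero hU 0 h0)
  · exact .inr (det_eq_zero_of_mul_row_eq_zero hU 0 h0)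
  obtain h1 | h1 | h1 := hrow 1
  · exact .inl (det_eq_zero_of_mul_row_eq_zero hU 1 h1)
  · exact .inr (det_eq_zero_of_mul_row_eq_zero hU 1 h1)
  exact absurd (eq_zero_of_mul_rows_eq_zero hU h0 h1) hk

/-- An entangled state occupies both rows, leaving room for at most one further nonzero vector in
each. Three other nonzero states cannot share these two places. -/
theorem RowSplit.det_eq_zero_of_four {ι : Type} {X : ι → Matrix (Fin 2) (Fin 2) ℂ}
    (h : RowSplit X) (hX : ∀ i, X i ≠ 0) {i j k l : ι} (hij : i ≠ j) (hik : i ≠ k) (hil : i ≠ l)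
    (hjk : j ≠ k) (hjl : j ≠ l) (hkl : k ≠ l) : (X i).det = 0 := by
  obtain ⟨U, hU, hUX⟩ := h
  by_contra hi
  have hrow : ∀ {s t : ι}, s ≠ t → i ≠ s → i ≠ t → ∀ r, (U * X s) r = 0 ∨ (U * X t) r = 0 :=
    fun {s t} hst his hit r =>
      (eq_zero_of_pairwise_orthogonal (hUX r i s his) (hUX r i t hit)
        (hUX r s t hst)).resolve_left fun h0 => hi (det_eq_zero_of_mul_row_eq_zero hU r h0)
  have hnz : ∀ {t r r'}, r ≠ r' → (U * X t) r = 0 → (U * X t) r' ≠ 0 := fun {t r r'} hr h h' => by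
    fin_cases r <;> fin_cases r'
    · exact hr rfl
    · exact hX t (eq_zero_of_mul_rows_eq_zero hU h h')
    · exact hX t (eq_zero_of_mul_rows_eq_zero hU h' h)
    · exact hr rfl
  have two : ∀ {s t o : ι}, s ≠ t → s ≠ o → t ≠ o → i ≠ s → i ≠ t → i ≠ o →
      ∀ r r' : Fin 2, r ≠ r' → (U * X s) r ≠ 0 := by
    intro s t o hst hso hto his hit hio r r' hr h
    have ht := (hrow hst his hit r').resolve_left (hnz hr h)
    have ho := (hrow hso his hio r').resolve_left (hnz hr h)
    obtain h | h := hrow hto hit hio r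
    · exact hnz hr h ht
    · exact hnz hr h ho
  obtain h | h := hrow hjk hij hik 0
  · exact two hjk hjl hkl hij hik hil 0 1 (by decide) h
  · exact two hjk.symm hkl hjl hik hij hil 0 1 (by decide) h

/-! ### Structure of locally distinguishable two-qubit families -/

open scoped ComplexOrder in
theorem trace_conjTranspose_mul_self_eq_zero {a b : ℕ} {X : Matrix (Fin a) (Fin b) ℂ} :
    (Xᴴ * X).trace = 0 ↔ X = 0 :=
  Matrix.trace_conjTranspose_mul_self_eq_zero_iff

theorem trace_conjTranspose_mul_of_scalar {a b : ℕ} {A : Matrix (Fin a) (Fin 2) ℂ}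
    {W : Matrix (Fin b) (Fin 2) ℂ} {d : ℂ} (hW : Wᴴ * W = d • 1)
    (X Y : Matrix (Fin 2) (Fin 2) ℂ) :
    ((A * X * Wᵀ)ᴴ * (A * Y * Wᵀ)).trace = d * (Xᴴ * (Aᴴ * A) * Y).trace := by
  have hW' : Wᵀ * Wᵀᴴ = d • 1 := by
    have := congrArg Matrix.transpose hW
    rw [Matrix.transpose_mul, Matrix.transpose_smul, Matrix.transpose_one] at this
    exact this
  have : (A * X * Wᵀ)ᴴ * (A * Y * Wᵀ) = Wᵀᴴ * (Xᴴ * (Aᴴ * A) * Y * Wᵀ) := by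
    simp only [Matrix.conjTranspose_mul, Matrix.mul_assoc]
  rw [this, Matrix.trace_mul_comm, Matrix.mul_assoc, hW', Matrix.mul_smul, Matrix.mul_one,
    Matrix.trace_smul, smul_eq_mul]

/-- A non-scalar Gram matrix `(K k * V)ᴴ * (K k * V)` serves as `M` in `RowSplit.of_trace`. If all
of them are scalar, the scalars sum to `c ≠ 0`, so one is nonzero and the protocol can be followed
along that outcome. -/
theorem rowSplit_or_exists_scalar {ι : Type} {X : ι → Matrix (Fin 2) (Fin 2) ℂ}
    (hX : ∀ i j, i ≠ j → ((X i)ᴴ * X j).trace = 0) {m a a' b : ℕ}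
    {K : Fin m → Matrix (Fin a') (Fin a) ℂ} (hK : ∑ k, (K k)ᴴ * K k = 1)
    {V : Matrix (Fin a) (Fin 2) ℂ} {W : Matrix (Fin b) (Fin 2) ℂ} {c d : ℂ} (hc : c ≠ 0)
    (hd : d ≠ 0) (hV : Vᴴ * V = c • 1) (hW : Wᴴ * W = d • 1)
    (h : ∀ k i j, i ≠ j → ((K k * (V * X i * Wᵀ))ᴴ * (K k * (V * X j * Wᵀ))).trace = 0) :
    RowSplit X ∨ ∃ k, ∃ e : ℂ, e ≠ 0 ∧ (K k * V)ᴴ * (K k * V) = e • 1 := by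
  by_cases hs : ∀ k, ∃ e : ℂ, (K k * V)ᴴ * (K k * V) = e • 1
  · right
    by_contra! hne
    choose e he using hs
    have he0 : ∀ k, e k = 0 := fun k => by
      by_contra h0
      exact hne k (e k) h0 (he k)
    have hsum : Vᴴ * V = ∑ k, (K k * V)ᴴ * (K k * V) := by
      have : ∀ k, (K k * V)ᴴ * (K k * V) = Vᴴ * ((K k)ᴴ * K k) * V := fun k => by
        simp only [Matrix.conjTranspose_mul, Matrix.mul_assoc]
      simp only [this]
      rw [← Matrix.sum_mul, ← Matrix.mul_sum, hK, Matrix.mul_one]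
    simp only [he, he0, zero_smul, Finset.sum_const_zero] at hsum
    rw [hsum] at hV
    have := congrFun (congrFun hV 0) 0
    simp at this
    exact hc this.symm
  · left
    push Not at hs
    obtain ⟨k, hk⟩ := hs
    refine .of_trace hX (Matrix.isHermitian_conjTranspose_mul_self (K k * V)) hk fun i j hij => ?_
    have := h k i j hij
    simp only [← Matrix.mul_assoc (K k)] at this
    rw [trace_conjTranspose_mul_of_scalar hW] at this
    exact (mul_eq_zero.1 this).resolve_left hd

/-- The structure of locally distinguishable two-qubit states: one of the parties can start with a
measurement in an orthonormal basis that preserves orthogonality. The statement is about states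
embedded into larger systems, for induction along the rounds of the measurement. -/
theorem MatrixDistinguishable.rowSplit_of_embedding {ι : Type} {X : ι → Matrix (Fin 2) (Fin 2) ℂ}
    (hX : ∀ i j, i ≠ j → ((X i)ᴴ * X j).trace = 0) {s t : ι} (hst : s ≠ t) (hX0 : ∀ i, X i ≠ 0)
    {a b : ℕ} {Z : ι → Matrix (Fin a) (Fin b) ℂ} (hZ : MatrixDistinguishable Z) :
    ∀ (V : Matrix (Fin a) (Fin 2) ℂ) (W : Matrix (Fin b) (Fin 2) ℂ) (c d : ℂ), c ≠ 0 → d ≠ 0 →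
      Vᴴ * V = c • 1 → Wᴴ * W = d • 1 → (∀ i, Z i = V * X i * Wᵀ) →
      RowSplit X ∨ RowSplit fun i => (X i)ᵀ := by
  have hXt : ∀ i j, i ≠ j → ((X i)ᵀᴴ * (X j)ᵀ).trace = 0 := fun i j hij => by
    rw [trace_conjTranspose_mul_transpose, hX i j hij]
  induction hZ with
  | @finish a b Z r h =>
    intro V W c d hc hd hV hW hZ
    -- Multiples of isometries with nonzero factor eliminate no state, so a leaf reached this way
    -- cannot separate `s` from `t`.
    have hne : ∀ i, Z i ≠ 0 := fun i h0 => by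
      have h1 := trace_conjTranspose_mul_of_scalar (A := V) hW (X i) (X i)
      rw [← hZ, h0, hV, Matrix.mul_smul, Matrix.mul_one, Matrix.smul_mul, Matrix.trace_smul,
        Matrix.mul_zero, Matrix.trace_zero, eq_comm, mul_eq_zero, smul_eq_zero,
        trace_conjTranspose_mul_self_eq_zero] at h1
      tauto
    exact absurd ((h s (hne s)).symm.trans (h t (hne t))) hst
  | @alice a b Z m a' K hK h ih =>
    intro V W c d hc hd hV hW hZ
    obtain hr | ⟨k, e, he, hk⟩ := rowSplit_or_exists_scalar hX hK hc hd hV hW fun k i j hij => by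
      rw [← hZ, ← hZ]
      exact (h k).trace_eq_zero hij
    · exact .inl hr
    · exact ih k (K k * V) W e d he hd hk hW fun i => by simp only [hZ, Matrix.mul_assoc]
  | @bob a b Z m b' K hK h ih =>
    intro V W c d hc hd hV hW hZ
    obtain hr | ⟨k, e, he, hk⟩ := rowSplit_or_exists_scalar hXt hK hd hc hW hV fun k i j hij => by
      have hZt : ∀ i, W * (X i)ᵀ * Vᵀ = (Z i)ᵀ := fun i => by
        simp only [hZ, Matrix.transpose_mul, Matrix.transpose_transpose, Matrix.mul_assoc]
      rw [hZt, hZt, ← (h k).trace_eq_zero hij, ← trace_conjTranspose_mul_transpose (Z i * _),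
        Matrix.transpose_mul, Matrix.transpose_mul, Matrix.transpose_transpose]
    · exact .inr hr
    · exact ih k V (K k * W) c e hc he hV hk fun i => by
        simp only [hZ, Matrix.mul_assoc, Matrix.transpose_mul]

theorem MatrixDistinguishable.rowSplit {ι : Type} {X : ι → Matrix (Fin 2) (Fin 2) ℂ}
    (h : MatrixDistinguishable X) {s t : ι} (hst : s ≠ t) (hX0 : ∀ i, X i ≠ 0) :
    RowSplit X ∨ RowSplit fun i => (X i)ᵀ :=
  h.rowSplit_of_embedding (fun _ _ => h.trace_eq_zero) hst hX0 1 1 1 1 one_ne_zero one_ne_zero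
    (by simp) (by simp) (by simp)

theorem MatrixDistinguishable.det_eq_zero_of_three {ι : Type}
    {X : ι → Matrix (Fin 2) (Fin 2) ℂ} (h : MatrixDistinguishable X) (hX0 : ∀ i, X i ≠ 0)
    {i j k : ι} (hij : i ≠ j) (hik : i ≠ k) (hjk : j ≠ k) :
    (X i).det = 0 ∨ (X j).det = 0 := by
  obtain h | h := h.rowSplit hij hX0
  · exact h.det_eq_zero_of_three hij hik hjk (hX0 k)
  · simpa only [Matrix.det_transpose] using
      h.det_eq_zero_of_three hij hik hjk (mt Matrix.transpose_eq_zero.1 (hX0 k))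

theorem MatrixDistinguishable.det_eq_zero_of_four {ι : Type}
    {X : ι → Matrix (Fin 2) (Fin 2) ℂ} (h : MatrixDistinguishable X) (hX0 : ∀ i, X i ≠ 0)
    {i j k l : ι} (hij : i ≠ j) (hik : i ≠ k) (hil : i ≠ l) (hjk : j ≠ k) (hjl : j ≠ l)
    (hkl : k ≠ l) : (X i).det = 0 := by
  obtain h | h := h.rowSplit hij hX0
  · exact h.det_eq_zero_of_four hX0 hij hik hil hjk hjl hkl
  · simpa only [Matrix.det_transpose] using
      h.det_eq_zero_of_four (fun i => mt Matrix.transpose_eq_zero.1 (hX0 i))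
        hij hik hil hjk hjl hkl

/-! ### Sufficient conditions for two, three and four states -/

theorem exists_vecMulVec_of_det_eq_zero {X : Matrix (Fin 2) (Fin 2) ℂ} (h : X.det = 0) :
    ∃ u v, X = Matrix.vecMulVec u v := by
  rw [Matrix.det_fin_two] at h
  by_cases h0 : X 0 = 0
  · refine ⟨![0, 1], X 1, ?_⟩
    ext i j
    fin_cases i
    · simpa [Matrix.vecMulVec_apply] using congrFun h0 j
    · simp [Matrix.vecMulVec_apply]
  · by_cases h00 : X 0 0 = 0
    · have h01 : X 0 1 ≠ 0 := fun h01 => h0 <| by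
        ext j
        fin_cases j
        · exact h00
        · exact h01
      refine ⟨![1, X 1 1 / X 0 1], X 0, ?_⟩
      ext i j
      fin_cases i <;> fin_cases j <;> simp [Matrix.vecMulVec_apply]
      · simp_all
      · field_simp
    · refine ⟨![1, X 1 0 / X 0 0], X 0, ?_⟩
      ext i j
      fin_cases i <;> fin_cases j <;> simp [Matrix.vecMulVec_apply]
      · field_simp
      · field_simp
        linear_combination h

theorem trace_conjTranspose_vecMulVec_mul (u v u' v' : Fin 2 → ℂ) :
    ((Matrix.vecMulVec u v)ᴴ * Matrix.vecMulVec u' v').trace =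
      (star u ⬝ᵥ u') * (star v ⬝ᵥ v') := by
  simp [Matrix.trace, Matrix.mul_apply, Matrix.vecMulVec_apply, dotProduct]
  ring

theorem vecMulVec_star_mul_vecMulVec (w u v : Fin 2 → ℂ) :
    Matrix.vecMulVec w (star w) * Matrix.vecMulVec u v =
      (star w ⬝ᵥ u) • Matrix.vecMulVec w v := by
  ext i j
  simp [Matrix.mul_apply, Matrix.vecMulVec_apply, dotProduct]
  ring

theorem exists_isHermitian_trace_eq_zero (X Y : Matrix (Fin 2) (Fin 2) ℂ) :
    ∃ M : Matrix (Fin 2) (Fin 2) ℂ, M.IsHermitian ∧ (∀ c : ℂ, M ≠ c • 1) ∧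
      (Xᴴ * M * Y).trace = 0 := by
  let σ : Fin 3 → Matrix (Fin 2) (Fin 2) ℂ :=
    ![!![1, 0; 0, -1], !![0, 1; 1, 0], !![0, -Complex.I; Complex.I, 0]]
  let f : (Fin 3 → ℝ) →ₗ[ℝ] ℂ :=
    Fintype.linearCombination ℝ fun k => (Xᴴ * σ k * Y).trace
  -- Traceless Hermitian matrices form a real space of dimension three, while the trace condition
  -- takes values in `ℂ`, of real dimension two. A nonzero traceless solution is not scalar.
  have hf : LinearMap.ker f ≠ ⊥ :=
    f.ker_ne_bot_of_finrank_lt (by simp [Complex.finrank_real_complex])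
  obtain ⟨v, hv, hv0⟩ := (Submodule.ne_bot_iff _).1 hf
  have hM : ∑ k, (v k : ℂ) • σ k =
      !![(v 0 : ℂ), v 1 - v 2 * Complex.I; v 1 + v 2 * Complex.I, -v 0] := by
    ext i j
    fin_cases i <;> fin_cases j <;> simp [σ, Fin.sum_univ_three, sub_eq_add_neg]
  refine ⟨∑ k, (v k : ℂ) • σ k, ?_, fun c hc => hv0 ?_, ?_⟩
  · rw [hM]
    ext i j
    fin_cases i <;> fin_cases j <;> simp [sub_eq_add_neg]
  · rw [hM] at hc
    have h00 := congrFun (congrFun hc 0) 0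
    have h11 := congrFun (congrFun hc 1) 1
    have h01 := congrFun (congrFun hc 0) 1
    simp [Complex.ext_iff] at h00 h11 h01
    ext k
    fin_cases k
    · simp
      linarith
    · exact h01.1
    · exact h01.2
  · have : f v = 0 := hv
    rw [← this, Fintype.linearCombination_apply]
    simp [Matrix.mul_sum, Matrix.sum_mul, Matrix.trace_sum]

theorem MatrixDistinguishable.of_transpose {ι : Type} {a b : ℕ}
    {X : ι → Matrix (Fin a) (Fin b) ℂ} (h : MatrixDistinguishable fun i => (X i)ᵀ) :
    MatrixDistinguishable X := by
  simpa only [Matrix.transpose_transpose] using h.transpose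

theorem MatrixDistinguishable.of_two {ι : Type} {X : ι → Matrix (Fin 2) (Fin 2) ℂ}
    (hX : ∀ i j, i ≠ j → ((X i)ᴴ * X j).trace = 0) {s t : ι} (hι : ∀ i, i = s ∨ i = t) :
    MatrixDistinguishable X := by
  have : Nonempty ι := ⟨s⟩
  obtain ⟨M, hM, hM', h⟩ := exists_isHermitian_trace_eq_zero (X s) (X t)
  have h' : ((X t)ᴴ * M * X s).trace = 0 := by
    rw [← star_eq_zero, ← Matrix.trace_conjTranspose, ← h]
    simp only [Matrix.conjTranspose_mul, Matrix.conjTranspose_conjTranspose, hM.eq,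
      Matrix.mul_assoc]
  refine (RowSplit.of_trace hX hM hM' fun i j hij => ?_).matrixDistinguishable
  obtain rfl | rfl := hι i <;> obtain rfl | rfl := hι j
  · exact absurd rfl hij
  · exact h
  · exact h'
  · exact absurd rfl hij

/-- Both products are eigenstates of the projector along `u`, so only pairs avoiding them impose a
condition. -/
theorem RowSplit.of_two_product {ι : Type} {X : ι → Matrix (Fin 2) (Fin 2) ℂ}
    (hX : ∀ i j, i ≠ j → ((X i)ᴴ * X j).trace = 0) {s t : ι} {u v u' v' : Fin 2 → ℂ}
    (hs : X s = Matrix.vecMulVec u v) (ht : X t = Matrix.vecMulVec u' v') (hs0 : X s ≠ 0)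
    (huu : star u ⬝ᵥ u' = 0)
    (h : ∀ i j, i ≠ j → i ≠ s → i ≠ t → j ≠ s → j ≠ t →
      ((X i)ᴴ * Matrix.vecMulVec u (star u) * X j).trace = 0) : RowSplit X := by
  have hu : u ≠ 0 := by
    rintro rfl
    exact hs0 (by rw [hs, Matrix.zero_vecMulVec])
  have hes : ∃ c : ℂ, Matrix.vecMulVec u (star u) * X s = c • X s :=
    ⟨_, by rw [hs, vecMulVec_star_mul_vecMulVec]⟩
  have het : ∃ c : ℂ, Matrix.vecMulVec u (star u) * X t = c • X t :=
    ⟨0, by rw [ht, vecMulVec_star_mul_vecMulVec, huu, zero_smul, zero_smul]⟩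
  refine .of_eigen hX (isHermitian_vecMulVec_star u) (vecMulVec_star_ne_smul_one hu)
    fun i j hij => ?_
  by_cases his : i = s
  · exact .inl (his ▸ hes)
  by_cases hit : i = t
  · exact .inl (hit ▸ het)
  by_cases hjs : j = s
  · exact .inr (.inl (hjs ▸ hes))
  by_cases hjt : j = t
  · exact .inr (.inl (hjt ▸ het))
  exact .inr (.inr (h i j hij his hit hjs hjt))

/-- Orthogonal products are orthogonal in one factor. The party holding it measures along the vector
there, and no pair avoids both products. -/
theorem MatrixDistinguishable.of_three {ι : Type} {X : ι → Matrix (Fin 2) (Fin 2) ℂ}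
    (hX : ∀ i j, i ≠ j → ((X i)ᴴ * X j).trace = 0) (hX0 : ∀ i, X i ≠ 0) {s t r : ι}
    (hst : s ≠ t) (hι : ∀ i, i = s ∨ i = t ∨ i = r) (hs : (X s).det = 0) (ht : (X t).det = 0) :
    MatrixDistinguishable X := by
  have : Nonempty ι := ⟨s⟩
  obtain ⟨u, v, hs⟩ := exists_vecMulVec_of_det_eq_zero hs
  obtain ⟨u', v', ht⟩ := exists_vecMulVec_of_det_eq_zero ht
  have h := hX s t hst
  rw [hs, ht, trace_conjTranspose_vecMulVec_mul, mul_eq_zero] at h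
  have hr : ∀ i j, i ≠ j → i ≠ s → i ≠ t → j ≠ s → j ≠ t → False := fun i j hij his hit hjs hjt =>
    hij ((((hι i).resolve_left his).resolve_left hit).trans
      (((hι j).resolve_left hjs).resolve_left hjt).symm)
  obtain h | h := h
  · exact (RowSplit.of_two_product hX hs ht (hX0 s) h fun i j hij his hit hjs hjt =>
      (hr i j hij his hit hjs hjt).elim).matrixDistinguishable
  · refine .of_transpose (RowSplit.of_two_product (X := fun i => (X i)ᵀ) (s := s) (t := t)
      (u := v) (v := u) (u' := v') (v' := u') (fun i j hij => ?_) ?_ ?_ ?_ h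
      fun i j hij his hit hjs hjt => (hr i j hij his hit hjs hjt).elim).matrixDistinguishable
    · rw [trace_conjTranspose_mul_transpose, hX i j hij]
    · rw [hs, Matrix.transpose_vecMulVec]
    · rw [ht, Matrix.transpose_vecMulVec]
    · exact mt Matrix.transpose_eq_zero.1 (hX0 s)

theorem MatrixDistinguishable.of_four_of_dotProduct_eq_zero {ι : Type} {u v : ι → Fin 2 → ℂ}
    (h : ∀ i j, i ≠ j → star (u i) ⬝ᵥ u j = 0 ∨ star (v i) ⬝ᵥ v j = 0)
    (h0 : ∀ i, Matrix.vecMulVec (u i) (v i) ≠ 0) {p q r s : ι} (hpr : p ≠ r)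
    (hps : p ≠ s) (hι : ∀ i, i = p ∨ i = q ∨ i = r ∨ i = s)
    (hpq : star (u p) ⬝ᵥ u q = 0) :
    MatrixDistinguishable fun i => Matrix.vecMulVec (u i) (v i) := by
  have : Nonempty ι := ⟨p⟩
  have hX : ∀ i j, i ≠ j →
      ((Matrix.vecMulVec (u i) (v i))ᴴ * Matrix.vecMulVec (u j) (v j)).trace = 0 :=
    fun i j hij => by rw [trace_conjTranspose_vecMulVec_mul, mul_eq_zero]; exact h i j hij
  have hXt : ∀ i j, i ≠ j →
      ((Matrix.vecMulVec (u i) (v i))ᵀᴴ * (Matrix.vecMulVec (u j) (v j))ᵀ).trace = 0 :=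
    fun i j hij => by rw [trace_conjTranspose_mul_transpose, hX i j hij]
  have htr : ∀ i j, ((Matrix.vecMulVec (u i) (v i))ᴴ * Matrix.vecMulVec (u p) (star (u p)) *
      Matrix.vecMulVec (u j) (v j)).trace =
      (star (u p) ⬝ᵥ u j) * ((star (u i) ⬝ᵥ u p) * (star (v i) ⬝ᵥ v j)) := fun i j => by
    rw [Matrix.mul_assoc, vecMulVec_star_mul_vecMulVec, Matrix.mul_smul, Matrix.trace_smul,
      trace_conjTranspose_vecMulVec_mul, smul_eq_mul]
  -- For the projector along `u p` only the pair `r`, `s` matters, and its trace is a product of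
  -- these three factors, up to conjugation. If none vanishes, `v p` is orthogonal to `v r` and `v
  -- s`. Then `p`, `r`, `s` are eigenstates of Bob's projector along `v p`, and every pair contains
  -- one of them.
  by_cases hcase : star (u p) ⬝ᵥ u r = 0 ∨ star (u p) ⬝ᵥ u s = 0 ∨ star (v r) ⬝ᵥ v s = 0
  · refine (RowSplit.of_two_product hX (s := p) (t := q) rfl rfl (h0 p) hpq
      fun i j hij hip hiq hjp hjq => ?_).matrixDistinguishable
    have hi := ((hι i).resolve_left hip).resolve_left hiq
    have hj := ((hι j).resolve_left hjp).resolve_left hjq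
    rw [htr]
    obtain rfl | rfl := hi <;> obtain rfl | rfl := hj
    · exact absurd rfl hij
    · obtain h | h | h := hcase
      · rw [star_dotProduct_eq_zero_symm h]; ring
      · rw [h]; ring
      · rw [h]; ring
    · obtain h | h | h := hcase
      · rw [h]; ring
      · rw [star_dotProduct_eq_zero_symm h]; ring
      · rw [star_dotProduct_eq_zero_symm h]; ring
    · exact absurd rfl hij
  · push Not at hcase
    have hr := (h p r hpr).resolve_left hcase.1
    have hs := (h p s hps).resolve_left hcase.2.1
    have hp0 : v p ≠ 0 := fun hv => h0 p (by rw [hv, Matrix.vecMulVec_zero])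
    have he : ∀ i, i ≠ q → ∃ c : ℂ, Matrix.vecMulVec (v p) (star (v p)) *
        (Matrix.vecMulVec (u i) (v i))ᵀ = c • (Matrix.vecMulVec (u i) (v i))ᵀ := fun i hi => by
      simp only [Matrix.transpose_vecMulVec, vecMulVec_star_mul_vecMulVec]
      obtain rfl | hi' | rfl | rfl := hι i
      · exact ⟨_, rfl⟩
      · exact absurd hi' hi
      · exact ⟨0, by rw [hr, zero_smul, zero_smul]⟩
      · exact ⟨0, by rw [hs, zero_smul, zero_smul]⟩
    refine .of_transpose (RowSplit.of_eigen hXt (isHermitian_vecMulVec_star (v p))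
      (vecMulVec_star_ne_smul_one hp0) fun i j hij => ?_).matrixDistinguishable
    by_cases hi : i = q
    · exact .inr (.inl (he j (hi ▸ hij.symm)))
    · exact .inl (he i hi)

theorem MatrixDistinguishable.of_four {ι : Type} {X : ι → Matrix (Fin 2) (Fin 2) ℂ}
    (hX : ∀ i j, i ≠ j → ((X i)ᴴ * X j).trace = 0) (hX0 : ∀ i, X i ≠ 0) {p q r s : ι}
    (hpq : p ≠ q) (hpr : p ≠ r) (hps : p ≠ s) (hι : ∀ i, i = p ∨ i = q ∨ i = r ∨ i = s)
    (hdet : ∀ i, (X i).det = 0) : MatrixDistinguishable X := by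
  choose u v huv using fun i => exists_vecMulVec_of_det_eq_zero (hdet i)
  obtain rfl : X = fun i => Matrix.vecMulVec (u i) (v i) := funext huv
  have h : ∀ i j, i ≠ j → star (u i) ⬝ᵥ u j = 0 ∨ star (v i) ⬝ᵥ v j = 0 := fun i j hij => by
    rw [← mul_eq_zero, ← trace_conjTranspose_vecMulVec_mul]
    exact hX i j hij
  obtain h1 | h1 := h p q hpq
  · exact .of_four_of_dotProduct_eq_zero h hX0 hpr hps hι h1
  · refine .of_transpose ?_
    simp only [Matrix.transpose_vecMulVec]
    refine .of_four_of_dotProduct_eq_zero (fun i j hij => (h i j hij).symm) (fun i h0 => hX0 i ?_)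
      hpr hps hι h1
    rw [← Matrix.transpose_eq_zero, Matrix.transpose_vecMulVec, h0]

/-! ### Compression of local images to two qubits -/

open scoped ComplexOrder in
/-- The range of a matrix with two columns is compressed isometrically into a qubit. -/
theorem exists_compression {a : ℕ} (A : Matrix (Fin a) (Fin 2) ℂ) :
    ∃ K : Matrix (Fin 2) (Fin a) ℂ, (Kᴴ * K) * (Kᴴ * K) = Kᴴ * K ∧ Kᴴ * K * A = A := by
  have hH := Matrix.isHermitian_conjTranspose_mul_self A
  set U : Matrix (Fin 2) (Fin 2) ℂ := (hH.eigenvectorUnitary : Matrix (Fin 2) (Fin 2) ℂ)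
  have hUU : U * Uᴴ = 1 := Unitary.coe_mul_star_self hH.eigenvectorUnitary
  have hUU' : Uᴴ * U = 1 := Unitary.coe_star_mul_self hH.eigenvectorUnitary
  set d : Fin 2 → ℝ := hH.eigenvalues with hd
  have hd0 : ∀ k, 0 ≤ d k :=
    fun k => (Matrix.posSemidef_conjTranspose_mul_self A).eigenvalues_nonneg k
  have hspec : Aᴴ * A = U * Matrix.diagonal (fun k => (d k : ℂ)) * Uᴴ := by
    have := hH.spectral_theorem
    rwa [Unitary.conjStarAlgAut_apply] at this
  set B : Matrix (Fin a) (Fin 2) ℂ := A * U with hB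
  have hBB : Bᴴ * B = Matrix.diagonal (fun k => (d k : ℂ)) := by
    rw [hB, Matrix.conjTranspose_mul, Matrix.mul_assoc, ← Matrix.mul_assoc Aᴴ, hspec,
      Matrix.mul_assoc, Matrix.mul_assoc, hUU', Matrix.mul_one, ← Matrix.mul_assoc, hUU',
      Matrix.one_mul]
  have hcol : ∀ k, d k = 0 → ∀ i, B i k = 0 := fun k hk i => by
    have h := congrFun (congrFun hBB k) k
    rw [Matrix.diagonal_apply_eq, hk, Complex.ofReal_zero, Matrix.mul_apply] at h
    have h' : ∑ j, Complex.normSq (B j k) = 0 := by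
      rw [← Complex.ofReal_eq_zero, ← h, Complex.ofReal_sum]
      refine Finset.sum_congr rfl fun j _ => ?_
      rw [Complex.normSq_eq_conj_mul_self]
      rfl
    exact Complex.normSq_eq_zero.1
      ((Finset.sum_eq_zero_iff_of_nonneg fun j _ => Complex.normSq_nonneg _).1 h' i
        (Finset.mem_univ i))
  -- The columns of `B` are orthogonal with squared norms `d k`; `K` normalizes them. Since `0⁻¹ =
  -- 0`, zero columns drop out, and `Kᴴ * K` is the projection onto the range of `A`.
  have hKK : (Matrix.diagonal (fun k => ((√(d k))⁻¹ : ℂ)) * Bᴴ)ᴴ *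
      (Matrix.diagonal (fun k => ((√(d k))⁻¹ : ℂ)) * Bᴴ) =
      B * Matrix.diagonal (fun k => ((d k)⁻¹ : ℂ)) * Bᴴ := by
    rw [Matrix.conjTranspose_mul, Matrix.conjTranspose_conjTranspose,
      Matrix.diagonal_conjTranspose, Matrix.mul_assoc, ← Matrix.mul_assoc (Matrix.diagonal _),
      Matrix.diagonal_mul_diagonal, ← Matrix.mul_assoc]
    congr 3
    ext k
    rw [Pi.star_apply, star_inv₀, ← mul_inv, Complex.star_def, Complex.conj_ofReal,
      ← Complex.ofReal_mul, Real.mul_self_sqrt (hd0 k)]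
  have hKB : B * Matrix.diagonal (fun k => ((d k)⁻¹ : ℂ)) * Bᴴ * B = B := by
    rw [Matrix.mul_assoc, hBB, Matrix.mul_assoc, Matrix.diagonal_mul_diagonal]
    ext i k
    rw [Matrix.mul_diagonal]
    by_cases hk : d k = 0
    · rw [hcol k hk, zero_mul]
    · rw [inv_mul_cancel₀ (by exact_mod_cast hk), mul_one]
  refine ⟨Matrix.diagonal (fun k => ((√(d k))⁻¹ : ℂ)) * Bᴴ, ?_, ?_⟩
  · rw [hKK]
    conv_lhs => rw [← Matrix.mul_assoc, ← Matrix.mul_assoc, hKB]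
  · have hA : A = B * Uᴴ := by rw [hB, Matrix.mul_assoc, hUU, Matrix.mul_one]
    rw [hKK, hA, ← Matrix.mul_assoc, hKB]

theorem MatrixDistinguishable.of_compression {ι : Type} [Nonempty ι] {a b : ℕ}
    {X : ι → Matrix (Fin a) (Fin b) ℂ} {K : Matrix (Fin 2) (Fin a) ℂ}
    (hK : (Kᴴ * K) * (Kᴴ * K) = Kᴴ * K) (hKX : ∀ i, Kᴴ * K * X i = X i)
    (h : MatrixDistinguishable fun i => K * X i) : MatrixDistinguishable X := by
  set R : Matrix (Fin a) (Fin a) ℂ := 1 - Kᴴ * K with hR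
  have hRR : Rᴴ * R = R := by
    have hRH : Rᴴ = R := by simp [hR]
    rw [hRH, hR]
    simp only [Matrix.mul_sub, Matrix.sub_mul, hK, Matrix.one_mul, Matrix.mul_one, sub_self,
      sub_zero]
  -- All outcomes of a round share the output dimension, here two. The complementary projection `R`
  -- is therefore split into its rows, each padded with a zero row; these outcomes never occur on
  -- the states.
  let N : Fin a → Matrix (Fin 2) (Fin a) ℂ :=
    fun j => Matrix.of fun r s => if r = 0 then R j s else 0
  refine .alice (a + 1) 2 (Fin.cons K N) ?_ fun k => ?_
  · have hN : ∑ j, (N j)ᴴ * N j = Rᴴ * R := by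
      ext s t
      simp [N, Matrix.sum_apply, Matrix.mul_apply]
    rw [Fin.sum_univ_succ]
    simp only [Fin.cons_zero, Fin.cons_succ]
    rw [hN, hRR, hR, add_sub_cancel]
  · refine Fin.cases ?_ (fun j => ?_) k
    · simpa only [Fin.cons_zero] using h
    · refine .finish (Classical.arbitrary ι) fun i hi => absurd ?_ hi
      have hRX : R * X i = 0 := by rw [hR, Matrix.sub_mul, Matrix.one_mul, hKX, sub_self]
      ext r t
      have := congrFun (congrFun hRX j) t
      rw [Matrix.mul_apply] at this
      simp only [Fin.cons_succ, N, Matrix.mul_apply, Matrix.of_apply, ite_mul, zero_mul]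
      split_ifs
      · exact this
      · simp

theorem trace_conjTranspose_mul_compression {a b : ℕ} {K : Matrix (Fin 2) (Fin a) ℂ}
    (X : Matrix (Fin a) (Fin b) ℂ) {Y : Matrix (Fin a) (Fin b) ℂ} (hY : Kᴴ * K * Y = Y) :
    ((K * X)ᴴ * (K * Y)).trace = (Xᴴ * Y).trace := by
  rw [Matrix.conjTranspose_mul, Matrix.mul_assoc, ← Matrix.mul_assoc Kᴴ, hY]

/-- Reduction of the images of two-qubit states under local operators to two-qubit states. -/
theorem exists_two_qubit_reduction {ι : Type} [Nonempty ι] {a b : ℕ}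
    {Y : ι → Matrix (Fin 2) (Fin 2) ℂ} {X : ι → Matrix (Fin a) (Fin b) ℂ}
    (A : Matrix (Fin a) (Fin 2) ℂ) (B : Matrix (Fin b) (Fin 2) ℂ)
    (hX : ∀ i, ∃ c : ℂ, X i = c • (A * Y i * Bᵀ)) :
    ∃ Z : ι → Matrix (Fin 2) (Fin 2) ℂ,
      (∀ i j, ((Z i)ᴴ * Z j).trace = ((X i)ᴴ * X j).trace) ∧
      (∀ i, (Y i).det = 0 → (Z i).det = 0) ∧
      (MatrixDistinguishable Z → MatrixDistinguishable X) := by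
  obtain ⟨K, hK, hKA⟩ := exists_compression A
  obtain ⟨L, hL, hLB⟩ := exists_compression B
  have hKX : ∀ i, Kᴴ * K * X i = X i := fun i => by
    obtain ⟨c, hc⟩ := hX i
    rw [hc, Matrix.mul_smul, ← Matrix.mul_assoc, ← Matrix.mul_assoc, hKA]
  have hLX : ∀ i, Lᴴ * L * (K * X i)ᵀ = (K * X i)ᵀ := fun i => by
    obtain ⟨c, hc⟩ := hX i
    simp only [hc, Matrix.transpose_mul, Matrix.transpose_smul, Matrix.transpose_transpose,
      Matrix.mul_smul]
    simp only [← Matrix.mul_assoc, hLB]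
  refine ⟨fun i => (L * (K * X i)ᵀ)ᵀ, fun i j => ?_, fun i hi => ?_, fun h => ?_⟩
  · rw [trace_conjTranspose_mul_transpose, trace_conjTranspose_mul_compression _ (hLX j),
      trace_conjTranspose_mul_transpose, trace_conjTranspose_mul_compression _ (hKX j)]
  · obtain ⟨c, hc⟩ := hX i
    have : L * (K * X i)ᵀ = c • ((L * B) * ((Y i)ᵀ * (K * A)ᵀ)) := by
      simp only [hc, Matrix.transpose_mul, Matrix.transpose_smul, Matrix.transpose_transpose,
        Matrix.mul_smul, Matrix.mul_assoc]
    rw [Matrix.det_transpose, this, Matrix.det_smul, Matrix.det_mul, Matrix.det_mul,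
      Matrix.det_transpose, hi, zero_mul, mul_zero, mul_zero]
  · exact .of_compression hK hKX (.of_transpose (.of_compression hL hLX h.of_transpose))

/-! ### Inheritance by surviving states and the final theorem -/

theorem Fintype.exists_cover_of_card_eq_three {ι : Type} [Fintype ι] (h : Fintype.card ι = 3) :
    ∃ s t r : ι, s ≠ t ∧ s ≠ r ∧ t ≠ r ∧ ∀ i, i = s ∨ i = t ∨ i = r := by
  let e := Fintype.equivFinOfCardEq h
  refine ⟨e.symm 0, e.symm 1, e.symm 2, by simp, by simp, by simp, fun i => ?_⟩
  simp only [Equiv.eq_symm_apply]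
  generalize e i = k
  revert k
  decide

theorem Fintype.exists_cover_of_card_eq_four {ι : Type} [Fintype ι] (h : Fintype.card ι = 4) :
    ∃ p q r s : ι, p ≠ q ∧ p ≠ r ∧ p ≠ s ∧ q ≠ r ∧ q ≠ s ∧ r ≠ s ∧
      ∀ i, i = p ∨ i = q ∨ i = r ∨ i = s := by
  let e := Fintype.equivFinOfCardEq h
  refine ⟨e.symm 0, e.symm 1, e.symm 2, e.symm 3, by simp, by simp, by simp, by simp, by simp,
    by simp, fun i => ?_⟩
  simp only [Equiv.eq_symm_apply]
  generalize e i = k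
  revert k
  decide

/-- Local distinguishability of at most four two-qubit states is inherited by orthogonal images of
some of them under local operators. -/
theorem MatrixDistinguishable.of_local_image {κ : Type} [Fintype κ] (hκ : Fintype.card κ ≤ 4)
    {Y : κ → Matrix (Fin 2) (Fin 2) ℂ} (hY : MatrixDistinguishable Y) (hY0 : ∀ i, Y i ≠ 0)
    {ι : Type} [Nonempty ι] {f : ι → κ} (hf : Function.Injective f) {a b : ℕ}
    {X : ι → Matrix (Fin a) (Fin b) ℂ} (A : Matrix (Fin a) (Fin 2) ℂ)
    (B : Matrix (Fin b) (Fin 2) ℂ) (hX : ∀ i, ∃ c : ℂ, X i = c • (A * Y (f i) * Bᵀ))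
    (hX0 : ∀ i, X i ≠ 0) (hXX : ∀ i j, i ≠ j → ((X i)ᴴ * X j).trace = 0) :
    MatrixDistinguishable X := by
  have : Fintype ι := Fintype.ofInjective f hf
  obtain ⟨Z, hZX, hdet, hZ⟩ := exists_two_qubit_reduction (Y := fun i => Y (f i)) A B hX
  refine hZ ?_
  have hZ0 : ∀ i, Z i ≠ 0 := fun i => by
    rw [ne_eq, ← trace_conjTranspose_mul_self_eq_zero, hZX, trace_conjTranspose_mul_self_eq_zero]
    exact hX0 i
  have hZZ : ∀ i j, i ≠ j → ((Z i)ᴴ * Z j).trace = 0 := fun i j hij => by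
    rw [hZX, hXX i j hij]
  have hcard := (Fintype.card_le_of_injective f hf).trans hκ
  have hpos : 0 < Fintype.card ι := Fintype.card_pos
  obtain h | h | h | h : Fintype.card ι = 1 ∨ Fintype.card ι = 2 ∨ Fintype.card ι = 3 ∨
    Fintype.card ι = 4 := by omega
  · obtain ⟨s, hs⟩ := Fintype.card_eq_one_iff.1 h
    exact .finish s fun j _ => (hs j).symm
  · let e := Fintype.equivFinOfCardEq h
    refine .of_two hZZ (s := e.symm 0) (t := e.symm 1) fun i => ?_
    simp only [Equiv.eq_symm_apply]
    omega
  · obtain ⟨s, t, r, hst, hsr, htr, hι⟩ := Fintype.exists_cover_of_card_eq_three h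
    -- Every pair among the three original states contains a product, so at least two are products;
    -- the cases choose which two.
    have h1 := hY.det_eq_zero_of_three hY0 (hf.ne hst) (hf.ne hsr) (hf.ne htr)
    have h2 := hY.det_eq_zero_of_three hY0 (hf.ne hsr) (hf.ne hst) (hf.ne htr.symm)
    have h3 := hY.det_eq_zero_of_three hY0 (hf.ne htr) (hf.ne hst.symm) (hf.ne hsr.symm)
    by_cases hs : (Y (f s)).det = 0
    · by_cases ht : (Y (f t)).det = 0
      · exact .of_three hZZ hZ0 hst hι (hdet s hs) (hdet t ht)
      · exact .of_three hZZ hZ0 (r := t) hsr (fun i => by have := hι i; tauto) (hdet s hs)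
          (hdet r (h3.resolve_left ht))
    · exact .of_three hZZ hZ0 (r := s) htr (fun i => by have := hι i; tauto)
        (hdet t (h1.resolve_left hs)) (hdet r (h2.resolve_left hs))
  · obtain ⟨p, q, r, s, hpq, hpr, hps, hqr, hqs, hrs, hι⟩ :=
      Fintype.exists_cover_of_card_eq_four h
    refine .of_four hZZ hZ0 hpq hpr hps hι fun i => hdet i ?_
    obtain rfl | rfl | rfl | rfl := hι i
    · exact hY.det_eq_zero_of_four hY0 (hf.ne hpq) (hf.ne hpr) (hf.ne hps) (hf.ne hqr)
        (hf.ne hqs) (hf.ne hrs)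
    · exact hY.det_eq_zero_of_four hY0 (hf.ne hpq.symm) (hf.ne hqr) (hf.ne hqs) (hf.ne hpr)
        (hf.ne hps) (hf.ne hrs)
    · exact hY.det_eq_zero_of_four hY0 (hf.ne hpr.symm) (hf.ne hqr.symm) (hf.ne hrs)
        (hf.ne hpq) (hf.ne hps) (hf.ne hqs)
    · exact hY.det_eq_zero_of_four hY0 (hf.ne hps.symm) (hf.ne hqs.symm) (hf.ne hrs.symm)
        (hf.ne hpq) (hf.ne hpr) (hf.ne hqr)

theorem LocallyDistinguishable.transformed {n : ℕ} (hn : n ≤ 4) {φ : Fin n → Bipartite 2 2}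
    (hφ0 : ∀ i, φ i ≠ 0) (hφ : LocallyDistinguishable φ) (P : LOCC 2 2)
    (hP : P.PreservesOrthogonality φ) (o : P.Outcome) (ho : Nonempty (P.Survivor o φ)) :
    LocallyDistinguishable (P.transformed o φ) := by
  rw [locallyDistinguishable_iff] at hφ ⊢
  have happ : ∀ i : P.Survivor o φ, P.apply o (φ i.1) ≠ 0 := fun i => by
    rw [← Bipartite.toMatrix_eq_zero.ne, LOCC.toMatrix_apply, ← LOCC.prob_pos_iff]
    exact i.2
  refine hφ.of_local_image (by simpa using hn) (fun i => Bipartite.toMatrix_eq_zero.ne.2 (hφ0 i))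
    (f := Subtype.val) Subtype.val_injective (P.opA o) (P.opB o) (fun i => ?_) (fun i => ?_)
    fun i j hij => ?_
  · exact ⟨_, by rw [← LOCC.toMatrix_apply, ← Bipartite.toMatrix_smul]; rfl⟩
  · rw [Bipartite.toMatrix_eq_zero.ne]
    refine smul_ne_zero ?_ (happ i)
    exact_mod_cast inv_ne_zero (norm_ne_zero_iff.2 (happ i))
  · rw [← Bipartite.inner_eq_trace]
    exact hP o hij

theorem proposition2 :
    (∀ n : ℕ, 2 ≤ n → n ≤ 4 → ∀ φ : Fin n → Bipartite 2 2, Orthonormal ℂ φ →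
      LocallyDistinguishable φ →
      ∀ P : LOCC 2 2, P.PreservesOrthogonality φ →
        ∀ o : P.Outcome, Nonempty (P.Survivor o φ) →
          LocallyDistinguishable (P.transformed o φ)) ∧
    (∀ (n : ℕ) (φ : Fin n → Bipartite 2 2), Orthonormal ℂ φ → ¬ ActivableNonlocality φ) := by
  refine ⟨fun n _ hn φ hφ hd P hP o ho => hd.transformed hn hφ.ne_zero P hP o ho, ?_⟩
  rintro n φ hφ ⟨hd, P, hP, hnd⟩
  have hn : n ≤ 4 := by
    simpa using hφ.linearIndependent.fintype_card_le_finrank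
  -- Every protocol on a nonzero space has an outcome, and the guess attached to it names a state.
  have : Nonempty (Fin n) := by
    obtain ⟨Q, guess, -⟩ := hd
    obtain ⟨o, -⟩ := Q.exists_outcome 1 one_ne_zero
    exact ⟨guess o⟩
  obtain ⟨i⟩ := this
  obtain ⟨o, ho⟩ := P.exists_outcome _ (Bipartite.toMatrix_eq_zero.ne.2 (hφ.ne_zero i))
  have hs : Nonempty (P.Survivor o φ) := ⟨⟨i, (P.prob_pos_iff o _).2 ho⟩⟩
  exact hnd o hs (hd.transformed hn hφ.ne_zero P hP o hs)
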